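/- Let $B$ be a real separable Banach space, let $(F_m)_{m\ge1}\subset B^\star$ satisfy $\|F_m\|=1$ and $\|x\|_B=\sup_m|F_m(x)|$ for all $x\in B$, and let $t_m>0$ with $\sum_m t_m=1$. Let $\widetilde H$ be the completion of $B$ under $\langle x,y\rangle_{\widetilde H}=\sum_m t_mF_m(x)F_m(y)$; each $F_m$ extends to $\widetilde H$ by continuity. Let $\|x\|_H^2=\sum_mF_m(x)^2$ and $\|x\|_{\widetilde H^\star}^2=\sum_m t_m^{-1}F_m(x)^2$ for $x\in B$, and let $H$, $\widetilde H^\star$ be the sets of $x\in B$ where these are finite. Let $X=(X_n)_{n\in\mathbb Z}$ be a standard ARB(1) process on a probability space: a zero mean, square integrable, strictly stationary $B$-valued process with $X_n=\rho(X_{n-1})+\varepsilon_n$ a.s., where $\rho\in\mathcal L(B)$, $\|\rho^{j_0}\|<1$ for some $j_0\ge1$, and $(\varepsilon_n)$ is i.i.d., zero mean and square integrable. On $\widetilde H$ let $C=\mathrm E[X_0\otimes X_0]=\sum_{j\ge1}C_j\,\phi_j\otimes\phi_j$ with $C_1\ge C_2\ge\cdots$ and $(\phi_j)$ orthonormal,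 and for $n\ge 2$ let $C_n=\frac1n\sum_{i=0}^{n-1}X_i\otimes X_i$, with a complete orthonormal system of eigenvectors $\phi_{n,j}$ and eigenvalues $C_{n,1}\ge\dots\ge C_{n,n}\ge0=C_{n,n+1}=\cdots$ (a.s.). Put $\phi'_{n,j}=\mathrm{sgn}\langle\phi_{n,j},\phi_j\rangle_{\widetilde H}\,\phi_j$, with $\mathrm{sgn}(x)=1$ for $x\ge0$ and $-1$ for $x<0$. Let $\mathcal H(X)=C^{1/2}(\widetilde H)$ with $\|h\|_{\mathcal H(X)}^2=\langle C^{-1}h,h\rangle_{\widetilde H}=\sum_jC_j^{-1}\langle h,\phi_j\rangle^2_{\widetilde H}$. Assume: A1. $\|X_0\|_B$ is a.s. bounded; $C_j>0$ and the eigenspace of $C_j$ is one-dimensional for every $j\ge1$. A2. $k_n\ge1$, $C_{n,k_n}>0$ a.s. for $n\ge 2$, $k_n\to\infty$ and $k_n/n\to0$. A3. $\sup_{\|x\|_B\le1}\big\|\rho(x)-\sum_{j=1}^k\langle\rho(x),\phi_j\rangle_{\widetilde H}\phi_j\big\|_B\to0$ as $k\to\infty$ (with $\phi_j\in B$). A4.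 $\mathcal H(X)$ is continuously embedded in $\widetilde H^\star$. A5. The embedding $\mathcal H(X)\hookrightarrow H$ is Hilbert–Schmidt, i.e. $\sum_j\|\sqrt{C_j}\,\phi_j\|_H^2<\infty$ (the vectors $\sqrt{C_j}\,\phi_j$ form an orthonormal basis of $\mathcal H(X)$). Let $\Lambda_k=\max_{1\le j\le k}(C_j-C_{j+1})^{-1}$, $N_m=\sum_jF_m(\phi_j)^2$ and $N=\sup_mN_m\in[0,\infty]$. Let $c=\sum_jC_j\phi_j\otimes\phi_j$, $c_n=\sum_jC_{n,j}\phi_{n,j}\otimes\phi_{n,j}$, $(c-c_n)(F_k,F_\ell)=\sum_jC_jF_k(\phi_j)F_\ell(\phi_j)-\sum_jC_{n,j}F_k(\phi_{n,j})F_\ell(\phi_{n,j})$ and $\|c-c_n\|_{B\times B}=\sup_{k,\ell\ge1}|(c-c_n)(F_k,F_\ell)|$. For $M,S\in[0,\infty]$ put $$R_n(M,S)=\max(M,\sqrt M)\Big[\|C-C_n\|_{\mathcal L(\widetilde H)}+2\max\big(\sqrt{\|C\|_{\mathcal L(\widetilde H)}},\sqrt{\|C_n\|_{\mathcal L(\widetilde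 H)}}\big)\,S\,\sqrt{8k_n\Lambda_{k_n}^2\|C_n-C\|_{\mathcal L(\widetilde H)}^2+\sum_{m>k_n}\|\phi_{n,m}-\phi'_{n,m}\|_{\widetilde H}^2}\;\Big]$$ (values in $[0,\infty]$, $0\cdot\infty=0$). If $\sqrt{k_n}\,\Lambda_{k_n}=o(\sqrt{n/\ln n})$ as $n\to\infty$, then almost surely, for all $n\ge2$, $$\|c-c_n\|_{B\times B}\le R_n\Big(N,\ \sup_{\ell\ge1}\sup_{m\ge1}|F_\ell(\phi'_{n,m})|\Big),$$ and for all $p,q\ge1$ $$|(c-c_n)(F_p,F_q)|\le R_n\Big(\max(N_p,N_q),\ \max\big(\sup_m|F_p(\phi'_{n,m})|,\sup_m|F_q(\phi'_{n,m})|\big)\Big).$$ Moreover $\|c-c_n\|_{B\times B}\to0$ almost surely as $n\to\infty$. -/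

import Mathlib

open MeasureTheory ProbabilityTheory Filter Topology Asymptotics
open scoped ENNReal NNReal InnerProductSpace

noncomputable section

/-- A norming sequence of unit functionals `F` on `B`, with positive weights `t` summing to `1`. -/
structure KuelbsData (B : Type*) [NormedAddCommGroup B] [NormedSpace ℝ B] where
  /-- the functionals -/
  F : ℕ → (B →L[ℝ] ℝ)
  /-- the weights -/
  t : ℕ → ℝ
  norm_F : ∀ n, ‖F n‖ = 1
  norming : ∀ x, IsLUB (Set.range fun n => |F n x|) ‖x‖
  t_pos : ∀ n, 0 < t n
  t_sum : HasSum t 1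

namespace KuelbsData

section Space

variable {B : Type*} [NormedAddCommGroup B] [NormedSpace ℝ B] (K : KuelbsData B)

theorem sq_term_le (x : B) (n : ℕ) :
    ‖Real.sqrt (K.t n) * K.F n x‖ ^ 2 ≤ K.t n * ‖x‖ ^ 2 := by
  have h : |K.F n x| ≤ ‖x‖ := (K.norming x).1 ⟨n, rfl⟩
  rw [norm_mul, mul_pow, Real.norm_eq_abs, Real.norm_eq_abs, sq_abs,
    Real.sq_sqrt (K.t_pos n).le]
  have := (K.t_pos n).le
  gcongr

theorem summable_sq_term (x : B) :
    Summable fun n => ‖Real.sqrt (K.t n) * K.F n x‖ ^ 2 :=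
  Summable.of_nonneg_of_le (fun _ => by positivity) (K.sq_term_le x)
    (K.t_sum.summable.mul_right _)

theorem memlp (x : B) : Memℓp (fun n => Real.sqrt (K.t n) * K.F n x) 2 := by
  apply memℓp_gen
  simpa using K.summable_sq_term x

/-- The map `x ↦ (√tₙ Fₙ(x))ₙ` of `B` into `ℓ²`; the inner product that it induces on `B` is
`⟪x, y⟫ = ∑ tₙ Fₙ(x) Fₙ(y)`. -/
def toL2 : B →L[ℝ] lp (fun _ : ℕ => ℝ) 2 :=
  LinearMap.mkContinuous
    { toFun := fun x => ⟨fun n => Real.sqrt (K.t n) * K.F n x, K.memlp x⟩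
      map_add' := fun x y => by
        ext n
        simp only [map_add, mul_add]
        rfl
      map_smul' := fun c x => by
        ext n
        simp [mul_left_comm] } 1 (fun x => by
    have hp : (0 : ℝ) < (2 : ℝ≥0∞).toReal := by norm_num
    refine lp.norm_le_of_tsum_le hp (by positivity) ?_
    have hs := K.summable_sq_term x
    have h1 : ∑' n, ‖Real.sqrt (K.t n) * K.F n x‖ ^ 2 ≤ ∑' n, K.t n * ‖x‖ ^ 2 :=
      hs.tsum_le_tsum (K.sq_term_le x) (K.t_sum.summable.mul_right _)
    rw [tsum_mul_right, K.t_sum.tsum_eq] at h1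
    simpa using h1)

theorem toL2_apply (x : B) (n : ℕ) :
    (K.toL2 x : ℕ → ℝ) n = Real.sqrt (K.t n) * K.F n x := rfl

/-- The Hilbert space `H̃`, the completion of `B` for the inner product `∑ tₙ Fₙ(x) Fₙ(y)`:
it is realised as the closure of the isometric copy of `B` in `ℓ²`. -/
abbrev Ht : Type := ↥(LinearMap.range (K.toL2 : B →ₗ[ℝ] lp (fun _ : ℕ => ℝ) 2)).topologicalClosure

/-- The embedding of `B` into `H̃`. -/
def emb : B →L[ℝ] K.Ht :=
  K.toL2.codRestrict _ fun x =>
    Submodule.le_topologicalClosure _ (LinearMap.mem_range_self _ x)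

theorem hasSum_inner_emb (x y : B) :
    HasSum (fun n => K.t n * (K.F n x * K.F n y)) ⟪K.emb x, K.emb y⟫_ℝ := by
  have h := lp.hasSum_inner (𝕜 := ℝ) (K.toL2 x) (K.toL2 y)
  have e : (fun n => ⟪(K.toL2 x : ℕ → ℝ) n, (K.toL2 y : ℕ → ℝ) n⟫_ℝ)
      = fun n => K.t n * (K.F n x * K.F n y) := by
    funext n
    rw [toL2_apply, toL2_apply, real_inner_eq_re_inner]
    simp only [RCLike.inner_apply, conj_trivial, RCLike.re_to_real]
    have := Real.mul_self_sqrt (K.t_pos n).le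
    linear_combination (K.F n x * K.F n y) * this
  rw [e] at h
  exact h

theorem denseRange_emb : DenseRange K.emb := by
  intro z
  rw [closure_subtype]
  have hz := z.2
  rw [← SetLike.mem_coe, Submodule.topologicalClosure_coe] at hz
  refine closure_mono ?_ hz
  rintro _ ⟨x, rfl⟩
  exact ⟨K.emb x, ⟨x, rfl⟩, rfl⟩

theorem emb_injective : Function.Injective K.emb := by
  intro x y h
  have h0 : ∀ n, K.F n x = K.F n y := fun n => by
    have := congrArg (fun z : K.Ht => (z : ℕ → ℝ) n) h
    change Real.sqrt (K.t n) * K.F n x = Real.sqrt (K.t n) * K.F n y at this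
    exact mul_left_cancel₀ (Real.sqrt_pos.2 (K.t_pos n)).ne' this
  have h1 : ‖x - y‖ ≤ 0 := (isLUB_le_iff (K.norming (x - y))).2 (by
    rintro _ ⟨n, rfl⟩
    simp [h0 n])
  exact sub_eq_zero.1 (norm_le_zero_iff.1 h1)

/-- The extension of `Fₙ` to `H̃` by continuity. -/
def Fext (n : ℕ) : K.Ht →L[ℝ] ℝ :=
  LinearMap.mkContinuous
    { toFun := fun h => (Real.sqrt (K.t n))⁻¹ * (h : ℕ → ℝ) n
      map_add' := fun x y => by simp [mul_add]
      map_smul' := fun c x => by simp [mul_left_comm] } (Real.sqrt (K.t n))⁻¹ (fun h => by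
    have := lp.norm_apply_le_norm (p := 2) (by norm_num) (h : lp (fun _ : ℕ => ℝ) 2) n
    simp only [LinearMap.coe_mk, AddHom.coe_mk, norm_mul, norm_inv, Real.norm_eq_abs,
      abs_of_nonneg (Real.sqrt_nonneg _)]
    exact mul_le_mul_of_nonneg_left this (by positivity))

theorem Fext_emb (n : ℕ) (x : B) : K.Fext n (K.emb x) = K.F n x := by
  change (Real.sqrt (K.t n))⁻¹ * (Real.sqrt (K.t n) * K.F n x) = K.F n x
  rw [inv_mul_cancel_left₀ (Real.sqrt_pos.2 (K.t_pos n)).ne']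

/-- `‖x‖_H² = ∑ Fₘ(x)²`, in `[0, ∞]`. -/
def hSq (x : B) : ℝ≥0∞ := ∑' m, ‖K.F m x‖ₑ ^ 2

/-- `‖x‖_{H̃*}² = ∑ Fₘ(x)² / tₘ`, in `[0, ∞]`. -/
def dualSq (x : B) : ℝ≥0∞ := ∑' m, ‖K.F m x‖ₑ ^ 2 / ENNReal.ofReal (K.t m)

end Space

end KuelbsData

/-- The standard ARB(1) process: `X` is a zero mean, square integrable, strictly stationary
solution of `Xₙ = ρ(Xₙ₋₁) + εₙ`, where `ε` is a strong white noise and some power of `ρ` is a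
strict contraction. -/
structure IsStandardARB1 {B Ω : Type*} [NormedAddCommGroup B] [NormedSpace ℝ B]
    [MeasurableSpace B] [MeasurableSpace Ω] (μ : Measure Ω)
    (ρ : B →L[ℝ] B) (ε X : ℤ → Ω → B) : Prop where
  contraction : ∃ j : ℕ, 1 ≤ j ∧ ‖ρ ^ j‖ < 1
  measurable_noise : ∀ n, Measurable (ε n)
  noise_indep : iIndepFun ε μ
  noise_ident : ∀ n, IdentDistrib (ε n) (ε 0) μ μ
  noise_memLp : ∀ n, MemLp (ε n) 2 μ
  noise_mean : ∀ n, ∫ ω, ε n ω ∂μ = 0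
  measurable : ∀ n, Measurable (X n)
  memLp : ∀ n, MemLp (X n) 2 μ
  mean : ∀ n, ∫ ω, X n ω ∂μ = 0
  stationary : ∀ h : ℤ,
    μ.map (fun ω (n : ℤ) => X (n + h) ω) = μ.map (fun ω (n : ℤ) => X n ω)
  state : ∀ n, ∀ᵐ ω ∂μ, X n ω = ρ (X (n - 1) ω) + ε n ω

section Operators

variable {H : Type*} [NormedAddCommGroup H] [InnerProductSpace ℝ H]

/-- The autocovariance operator `E[Y ⊗ Y]`. -/
def covOp {Ω : Type*} [MeasurableSpace Ω] (μ : Measure Ω) (Y : Ω → H) : H →L[ℝ] H :=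
  ∫ ω, InnerProductSpace.rankOne ℝ (Y ω) (Y ω) ∂μ

/-- The empirical autocovariance operator `n⁻¹ ∑_{i < n} Yᵢ ⊗ Yᵢ`. -/
def empCovOp (Y : ℤ → H) (n : ℕ) : H →L[ℝ] H :=
  (n : ℝ)⁻¹ • ∑ i ∈ Finset.range n, InnerProductSpace.rankOne ℝ (Y i) (Y i)

/-- `T = ∑ lamⱼ φⱼ ⊗ φⱼ`, with `φ` orthonormal and `lam` nonincreasing. The index `j` of the code
stands for the index `j + 1` of the usual numbering, here and below. -/
structure IsSpectralSystem (T : H →L[ℝ] H) (lam : ℕ → ℝ) (φ : ℕ → H) : Prop where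
  orthonormal : Orthonormal ℝ φ
  antitone : Antitone lam
  hasSum : ∀ f, HasSum (fun j => (lam j * ⟪f, φ j⟫_ℝ) • φ j) (T f)

/-- The empirical eigenelements: `φ` is a complete orthonormal system of eigenvectors of `T` and
`lam₁ ≥ ⋯ ≥ lamₙ ≥ 0 = lamₙ₊₁ = lamₙ₊₂ = ⋯` are the eigenvalues. -/
structure IsEmpSpectralSystem (n : ℕ) (T : H →L[ℝ] H) (lam : ℕ → ℝ) (φ : ℕ → H) : Prop where
  orthonormal : Orthonormal ℝ φ
  complete : (Submodule.span ℝ (Set.range φ)).topologicalClosure = ⊤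
  antitone : Antitone lam
  nonneg : ∀ j, 0 ≤ lam j
  zero : ∀ j, n ≤ j → lam j = 0
  eigen : ∀ j, T (φ j) = lam j • φ j

/-- The vector `sgn⟪ψ, φ⟫ φ`, with `sgn x = 1` for `x ≥ 0` and `sgn x = -1` for `x < 0`. -/
def signAlign (ψ φ : H) : H := (if 0 ≤ ⟪ψ, φ⟫_ℝ then (1 : ℝ) else -1) • φ

/-- `‖h‖²_{H(X)} = ⟪C⁻¹ h, h⟫ = ∑ ⟪h, φⱼ⟫² / Cⱼ`, in `[0, ∞]`. -/
def rkhsSq (lam : ℕ → ℝ) (φ : ℕ → H) (h : H) : ℝ≥0∞ :=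
  ∑' j, ENNReal.ofReal (⟪h, φ j⟫_ℝ ^ 2 / lam j)

/-- The reproducing kernel Hilbert space `H(X) = C^{1/2}(H̃)`, as a set. -/
def rkhs (lam : ℕ → ℝ) (φ : ℕ → H) : Set H :=
  {h | h ∈ (Submodule.span ℝ (Set.range φ)).topologicalClosure ∧ rkhsSq lam φ h < ∞}

end Operators

/-- `Λ_k = max_{1 ≤ j ≤ k} (Cⱼ - Cⱼ₊₁)⁻¹`. -/
def gapSup (lam : ℕ → ℝ) (k : ℕ) : ℝ := ⨆ j : Fin k, (lam j - lam (j + 1))⁻¹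

section Assumptions

variable {B Ω : Type*} [NormedAddCommGroup B] [NormedSpace ℝ B] [MeasurableSpace Ω]

/-- `X₀` is almost surely bounded, and the eigenvalues `Cⱼ` are positive and simple. -/
def AssumptionA1 {H : Type*} [NormedAddCommGroup H] [InnerProductSpace ℝ H]
    (μ : Measure Ω) (X : ℤ → Ω → B) (C : H →L[ℝ] H) (lam : ℕ → ℝ) : Prop :=
  (∃ M : ℝ, ∀ᵐ ω ∂μ, ‖X 0 ω‖ ≤ M) ∧
    ∀ j, 0 < lam j ∧
      Module.finrank ℝ (Module.End.eigenspace (C : H →ₗ[ℝ] H) (lam j)) = 1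

/-- `C_{n,kₙ} > 0` almost surely, `kₙ → ∞` and `kₙ / n → 0`. -/
def AssumptionA2 (μ : Measure Ω) (lamn : ℕ → Ω → ℕ → ℝ) (k : ℕ → ℕ) : Prop :=
  (∀ n, 2 ≤ n → 1 ≤ k n ∧ ∀ᵐ ω ∂μ, 0 < lamn n ω (k n - 1)) ∧
    Tendsto k atTop atTop ∧ Tendsto (fun n => (k n : ℝ) / n) atTop (𝓝 0)

namespace KuelbsData

variable (K : KuelbsData B)

/-- `sup_{‖x‖ ≤ 1} ‖ρ(x) - ∑_{j ≤ k} ⟪ρ(x), φⱼ⟫ φⱼ‖_B → 0`; here `b j` is `φⱼ` as an element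
of `B`. -/
def AssumptionA3 (ρ : B →L[ℝ] B) (φ : ℕ → K.Ht) : Prop :=
  ∃ b : ℕ → B, (∀ j, K.emb (b j) = φ j) ∧
    Tendsto (fun k : ℕ => ⨆ x : {x : B // ‖x‖ ≤ 1},
      ‖ρ x - ∑ j ∈ Finset.range k, ⟪K.emb (ρ x), φ j⟫_ℝ • b j‖ₑ) atTop (𝓝 0)

/-- `H(X)` is continuously embedded into `H̃* = {x ∈ B : ∑ Fₘ(x)² / tₘ < ∞}`. -/
def AssumptionA4 (lam : ℕ → ℝ) (φ : ℕ → K.Ht) : Prop :=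
  ∃ c : ℝ≥0, ∀ h ∈ rkhs lam φ, ∃ x : B, K.emb x = h ∧ K.dualSq x ≤ c * rkhsSq lam φ h

/-- The embedding of `H(X)` into `H` is Hilbert-Schmidt: the squared `H`-norms of the vectors
`√Cⱼ φⱼ`, which form an orthonormal basis of `H(X)`, are summable. -/
def AssumptionA5 (lam : ℕ → ℝ) (φ : ℕ → K.Ht) : Prop :=
  ∃ b : ℕ → B, (∀ j, K.emb (b j) = φ j) ∧ ∑' j, K.hSq (Real.sqrt (lam j) • b j) < ∞

/-- `Nₘ = ∑ⱼ Fₘ(φⱼ)²`. -/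
def Nseq (φ : ℕ → K.Ht) (m : ℕ) : ℝ≥0∞ := ∑' j, ‖K.Fext m (φ j)‖ₑ ^ 2

/-- `N = supₘ Nₘ`. -/
def Nsup (φ : ℕ → K.Ht) : ℝ≥0∞ := ⨆ m, K.Nseq φ m

/-- The value of the kernel `∑ⱼ lamⱼ φⱼ ⊗ φⱼ` at `(F_k, F_l)`. -/
def kernel (lam : ℕ → ℝ) (φ : ℕ → K.Ht) (k l : ℕ) : ℝ :=
  ∑' j, lam j * (K.Fext k (φ j) * K.Fext l (φ j))

/-- The series that defines the kernel converges absolutely. -/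
theorem summable_kernel {lam : ℕ → ℝ} {φ : ℕ → K.Ht} (hφ : Orthonormal ℝ φ)
    (hlam : Antitone lam) (h0 : ∀ j, 0 ≤ lam j) (k l : ℕ) :
    Summable fun j => lam j * (K.Fext k (φ j) * K.Fext l (φ j)) := by
  have hsq : ∀ m, Summable fun j => (K.Fext m (φ j)) ^ 2 := fun m => by
    have h := hφ.inner_products_summable ((InnerProductSpace.toDual ℝ K.Ht).symm (K.Fext m))
    refine h.congr fun j => ?_
    rw [real_inner_comm, InnerProductSpace.toDual_symm_apply, Real.norm_eq_abs, sq_abs]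
  refine Summable.of_norm_bounded (((hsq k).add (hsq l)).mul_left (lam 0)) fun j => ?_
  rw [norm_mul, Real.norm_eq_abs, Real.norm_eq_abs, abs_of_nonneg (h0 j)]
  refine mul_le_mul (hlam (Nat.zero_le j)) ?_ (abs_nonneg _) (h0 0)
  rw [abs_le]
  constructor <;>
    nlinarith [sq_nonneg (K.Fext k (φ j) + K.Fext l (φ j)),
      sq_nonneg (K.Fext k (φ j) - K.Fext l (φ j)), sq_nonneg (K.Fext k (φ j)),
      sq_nonneg (K.Fext l (φ j))]

end KuelbsData

end Assumptions

/-- `‖a‖_{B × B} = sup_{k, l} |a(F_k, F_l)|`, in `[0, ∞]`. -/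
def kernelNorm (a : ℕ → ℕ → ℝ) : ℝ≥0∞ := ⨆ k, ⨆ l, ‖a k l‖ₑ

/-- The square root on `[0, ∞]`. -/
def esqrt (x : ℝ≥0∞) : ℝ≥0∞ := x ^ (1 / 2 : ℝ)

/-- `max(N, √N) [‖C - Cₙ‖ + 2 max(√‖C‖, √‖Cₙ‖) S √(8 k Λ² ‖Cₙ - C‖² + ∑_{m > k} ‖ψₘ - ψ'ₘ‖²)]`,
where `ψ'ₘ = sgn⟪ψₘ, φₘ⟫ φₘ`. -/
def svBound {H : Type*} [NormedAddCommGroup H] [InnerProductSpace ℝ H] (N S : ℝ≥0∞)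
    (C Cn : H →L[ℝ] H) (φ ψ : ℕ → H) (k : ℕ) (Λ : ℝ) : ℝ≥0∞ :=
  max N (esqrt N) *
    (‖C - Cn‖ₑ + 2 * max (esqrt ‖C‖ₑ) (esqrt ‖Cn‖ₑ) * S *
      esqrt ((k : ℝ≥0∞) * 8 * ‖Λ‖ₑ ^ 2 * ‖Cn - C‖ₑ ^ 2 +
        ∑' m : ℕ, ‖ψ (k + m) - signAlign (ψ (k + m)) (φ (k + m))‖ₑ ^ 2))

end

/-! ### Quadratic forms on a Hilbert space and their spectral expansions. -/

section Hilbert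

variable {H : Type*} [NormedAddCommGroup H] [InnerProductSpace ℝ H]

/-! Put `D = C - Cₙ` and let `r_p` be the Riesz vector of `F_p` in `H̃`. Both kernels are spectral
expansions, so their difference at `(F_p, F_q)` is `⟪D r_p, r_q⟫`. Let `u_p` be the projection of
`r_p` onto the closed span of the `φⱼ`; then `‖u_p‖² = N_p`. The vector `v = r_p - u_p` is killed by
`C`, and since `E⟪X₀, v⟫² = ⟪C v, v⟫ = 0` the whole process is a.s. orthogonal to it, so `Cₙ` kills
it too. Hence `u_p` may replace `r_p`, and Cauchy-Schwarz gives `max(N_p, N_q) ‖D‖`, which the first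
summand of the bound already dominates (`ae_enorm_inner_sub_le`, `le_svBound`).

Convergence takes another route, which needs no finiteness of `N`: a strong law for `X ⊗ X` in the
norm of operators from the dual of `B` to `B` is uniform over unit functionals
(`tendsto_average_dualTensor`). There, `Xᵢ - ρᵐ Xᵢ₋ₘ` is a.s. a sum over the last `m` innovations,
so terms `m` apart are independent and the Banach-valued strong law applies along residue classes
mod `m`. Boundedness and a small `‖ρᵐ‖` carry the result over to `X`. -/

/-- The component of `f` along the span of an orthonormal sequence. -/
theorem Orthonormal.exists_projection [CompleteSpace H] {φ : ℕ → H} (hφ : Orthonormal ℝ φ)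
    (f : H) : ∃ u : H, (∀ j, ⟪u, φ j⟫_ℝ = ⟪f, φ j⟫_ℝ) ∧
      ‖u‖ₑ ^ 2 = ∑' j, ‖⟪f, φ j⟫_ℝ‖ₑ ^ 2 := by
  have hs : Summable fun j => ⟪f, φ j⟫_ℝ • φ j := by
    have h := (hφ.orthogonalFamily.summable_iff_norm_sq_summable fun j => ⟪f, φ j⟫_ℝ).2 (by
      refine (hφ.inner_products_summable f).congr fun j => ?_
      rw [real_inner_comm])
    simpa using h
  obtain ⟨u, hu⟩ := hs
  have hin : ∀ j, ⟪u, φ j⟫_ℝ = ⟪f, φ j⟫_ℝ := fun k => by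
    have h1 := hu.mapL (innerSL ℝ (φ k))
    simp only [innerSL_apply_apply, inner_smul_right, orthonormal_iff_ite.1 hφ, mul_ite, mul_one,
      mul_zero] at h1
    have h2 := hasSum_ite_eq k (⟪f, φ k⟫_ℝ)
    rw [real_inner_comm]
    refine h1.unique (h2.congr_fun ?_)
    intro j
    by_cases hj : j = k
    · simp [hj]
    · simp [hj, Ne.symm hj]
  refine ⟨u, hin, ?_⟩
  -- Pairing `u` with its own expansion gives Parseval's identity.
  have h1 := hu.mapL (innerSL ℝ u)
  simp only [innerSL_apply_apply, inner_smul_right, hin, real_inner_self_eq_norm_sq] at h1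
  have h2 : ∀ x : ℝ, ‖x‖ₑ ^ 2 = ENNReal.ofReal (x * x) := fun x => by
    rw [← ofReal_norm, ← ENNReal.ofReal_pow (norm_nonneg _), Real.norm_eq_abs, sq_abs, sq]
  simp only [h2]
  rw [← ENNReal.ofReal_tsum_of_nonneg (fun j => mul_self_nonneg _) h1.summable, h1.tsum_eq,
    ← ofReal_norm, ENNReal.ofReal_pow (norm_nonneg _)]

/-- Symmetry lets the second argument be replaced as well as the first; then Cauchy-Schwarz and `ab
≤ max(a², b²)`. -/
theorem enorm_inner_le_of_symmetric {D : H →L[ℝ] H} (hD : ∀ x y, ⟪D x, y⟫_ℝ = ⟪x, D y⟫_ℝ)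
    {f g u v : H} (hf : D f = D u) (hg : D g = D v) :
    ‖⟪D f, g⟫_ℝ‖ₑ ≤ max (‖u‖ₑ ^ 2) (‖v‖ₑ ^ 2) * ‖D‖ₑ := by
  have h1 : ⟪D f, g⟫_ℝ = ⟪D u, v⟫_ℝ := by rw [hf, hD, hg, ← hD]
  have h2 : ‖⟪D u, v⟫_ℝ‖ ≤ max (‖u‖ ^ 2) (‖v‖ ^ 2) * ‖D‖ := by
    calc ‖⟪D u, v⟫_ℝ‖ ≤ ‖D u‖ * ‖v‖ := norm_inner_le_norm _ _
      _ ≤ (‖D‖ * ‖u‖) * ‖v‖ := by gcongr; exact D.le_opNorm u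
      _ = (‖u‖ * ‖v‖) * ‖D‖ := by ring
      _ ≤ _ := by
        gcongr
        rcases le_total ‖u‖ ‖v‖ with h | h
        · exact le_max_of_le_right (by nlinarith [norm_nonneg u, norm_nonneg v])
        · exact le_max_of_le_left (by nlinarith [norm_nonneg u, norm_nonneg v])
  rw [h1]
  simp only [← ofReal_norm, ← ENNReal.ofReal_pow (norm_nonneg _)]
  rw [← ENNReal.ofReal_max, ← ENNReal.ofReal_mul (by positivity)]
  exact ENNReal.ofReal_le_ofReal h2

theorem le_svBound (N S : ℝ≥0∞) (C Cn : H →L[ℝ] H) (φ ψ : ℕ → H) (k : ℕ) (Λ : ℝ) :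
    N * ‖C - Cn‖ₑ ≤ svBound N S C Cn φ ψ k Λ :=
  mul_le_mul' (le_max_left _ _) le_self_add

theorem IsSpectralSystem.hasSum_inner {T : H →L[ℝ] H} {lam : ℕ → ℝ} {φ : ℕ → H}
    (h : IsSpectralSystem T lam φ) (f g : H) :
    HasSum (fun j => lam j * (⟪f, φ j⟫_ℝ * ⟪g, φ j⟫_ℝ)) ⟪T f, g⟫_ℝ := by
  have h1 := (h.hasSum f).mapL (innerSL ℝ g)
  simp only [innerSL_apply_apply, inner_smul_right] at h1
  rw [real_inner_comm]
  exact h1.congr_fun fun j => by ring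

/-- Only the eigenvector equations are given, so Parseval in the complete system is combined with
moving `T` onto `φ j` by symmetry. -/
theorem IsEmpSpectralSystem.hasSum_inner [CompleteSpace H] {n : ℕ} {T : H →L[ℝ] H} {lam : ℕ → ℝ}
    {φ : ℕ → H} (h : IsEmpSpectralSystem n T lam φ) (hT : ∀ x y, ⟪T x, y⟫_ℝ = ⟪x, T y⟫_ℝ)
    (f g : H) :
    HasSum (fun j => lam j * (⟪f, φ j⟫_ℝ * ⟪g, φ j⟫_ℝ)) ⟪T f, g⟫_ℝ := by
  let b : HilbertBasis ℕ ℝ H := HilbertBasis.mk h.orthonormal h.complete.ge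
  have hb : ∀ j, b j = φ j := fun j => by simp [b]
  refine (b.hasSum_inner_mul_inner (T f) g).congr_fun fun j => ?_
  rw [hb, hT, h.eigen, inner_smul_right, real_inner_comm g]
  ring

theorem inner_empCovOp (Y : ℤ → H) (n : ℕ) (f g : H) :
    ⟪empCovOp Y n f, g⟫_ℝ
      = (n : ℝ)⁻¹ * ∑ i ∈ Finset.range n, ⟪Y i, f⟫_ℝ * ⟪Y i, g⟫_ℝ := by
  simp [empCovOp, inner_smul_left, sum_inner]

theorem empCovOp_eq_zero {Y : ℤ → H} {f : H} (hf : ∀ i, ⟪Y i, f⟫_ℝ = 0) (n : ℕ) :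
    empCovOp Y n f = 0 := by
  simp [empCovOp, hf]

theorem inner_covOp [CompleteSpace H] {Ω : Type*} [MeasurableSpace Ω] {μ : Measure Ω}
    {Y : Ω → H} (hY : Integrable (fun ω => InnerProductSpace.rankOne ℝ (Y ω) (Y ω)) μ) (f g : H) :
    ⟪covOp μ Y f, g⟫_ℝ = ∫ ω, ⟪Y ω, f⟫_ℝ * ⟪Y ω, g⟫_ℝ ∂μ := by
  have h := ((innerSL ℝ g).comp (ContinuousLinearMap.apply ℝ H f)).integral_comp_comm hY
  rw [real_inner_comm]
  simp only [ContinuousLinearMap.comp_apply, ContinuousLinearMap.apply_apply,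
    innerSL_apply_apply, InnerProductSpace.rankOne_apply, inner_smul_right] at h
  rw [covOp, ← h]
  refine integral_congr_ae (.of_forall fun ω => ?_)
  simp only [real_inner_comm g]

theorem integrable_inner_mul_inner [CompleteSpace H] {Ω : Type*} [MeasurableSpace Ω]
    {μ : Measure Ω} {Y : Ω → H}
    (hY : Integrable (fun ω => InnerProductSpace.rankOne ℝ (Y ω) (Y ω)) μ) (f g : H) :
    Integrable (fun ω => ⟪Y ω, f⟫_ℝ * ⟪Y ω, g⟫_ℝ) μ := by
  refine (((innerSL ℝ g).comp (ContinuousLinearMap.apply ℝ H f)).integrable_comp hY).congr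
    (.of_forall fun ω => ?_)
  simp only [ContinuousLinearMap.comp_apply, ContinuousLinearMap.apply_apply,
    innerSL_apply_apply, InnerProductSpace.rankOne_apply, inner_smul_right]
  rw [real_inner_comm g]

theorem integrable_rankOne_of_bound {Ω : Type*} [MeasurableSpace Ω] {μ : Measure Ω}
    [IsFiniteMeasure μ] {Y : Ω → H} (hY : AEStronglyMeasurable Y μ) {M : ℝ}
    (hM : ∀ᵐ ω ∂μ, ‖Y ω‖ ≤ M) :
    Integrable (fun ω => InnerProductSpace.rankOne ℝ (Y ω) (Y ω)) μ := by
  refine Integrable.of_bound (C := M * M) ?_ ?_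
  · have hc : Continuous fun y : H => InnerProductSpace.rankOne ℝ y y :=
      (InnerProductSpace.rankOne ℝ (E := H) (F := H)).continuous₂.comp
        (continuous_id.prodMk continuous_id)
    exact hc.comp_aestronglyMeasurable hY
  · filter_upwards [hM] with ω h
    rw [InnerProductSpace.norm_rankOne]
    gcongr
    exact (norm_nonneg _).trans h

end Hilbert

/-! ### Kernels as quadratic forms at Riesz vectors. -/

namespace KuelbsData

variable {B : Type*} [NormedAddCommGroup B] [NormedSpace ℝ B] (K : KuelbsData B)

/-- The vector of `H̃` that represents the extension of `Fₙ`. -/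
noncomputable def riesz (m : ℕ) : K.Ht := (InnerProductSpace.toDual ℝ K.Ht).symm (K.Fext m)

theorem inner_riesz (m : ℕ) (x : K.Ht) : ⟪x, K.riesz m⟫_ℝ = K.Fext m x := by
  rw [real_inner_comm, riesz, InnerProductSpace.toDual_symm_apply]

theorem kernel_eq_inner {T : K.Ht →L[ℝ] K.Ht} {lam : ℕ → ℝ} {φ : ℕ → K.Ht} {p q : ℕ}
    (h : HasSum (fun j => lam j * (⟪K.riesz p, φ j⟫_ℝ * ⟪K.riesz q, φ j⟫_ℝ))
      ⟪T (K.riesz p), K.riesz q⟫_ℝ) :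
    K.kernel lam φ p q = ⟪T (K.riesz p), K.riesz q⟫_ℝ := by
  rw [← h.tsum_eq, kernel]
  simp only [real_inner_comm _ (K.riesz _), inner_riesz]

end KuelbsData

/-! ### Cesàro averages along residue classes. -/

section Cesaro

variable {E : Type*} [NormedAddCommGroup E] [NormedSpace ℝ E]

omit [NormedSpace ℝ E] in
theorem sum_range_mul_eq_sum_residues (a : ℕ → E) (m N : ℕ) :
    ∑ i ∈ Finset.range (m * N), a i
      = ∑ r ∈ Finset.range m, ∑ l ∈ Finset.range N, a (m * l + r) := by
  induction N with
  | zero => simp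
  | succ N ih =>
    rw [Nat.mul_succ, Finset.sum_range_add, ih]
    simp [Finset.sum_range_succ, Finset.sum_add_distrib]

/-- The first `m * (n / m)` terms split into `m` residue classes, whose averages over `n / m ≤ n`
terms dominate; the fewer than `m` leftover terms cost at most `m M / n`. -/
theorem tendsto_average_zero_of_residues {a : ℕ → E} {m : ℕ} (hm : 0 < m) {M : ℝ}
    (hM : ∀ i, ‖a i‖ ≤ M)
    (h : ∀ r, Tendsto (fun N : ℕ => (N : ℝ)⁻¹ • ∑ l ∈ Finset.range N, a (m * l + r))
      atTop (𝓝 0)) :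
    Tendsto (fun n : ℕ => (n : ℝ)⁻¹ • ∑ i ∈ Finset.range n, a i) atTop (𝓝 0) := by
  have hM0 : 0 ≤ M := (norm_nonneg _).trans (hM 0)
  have h1 : Tendsto (fun N : ℕ => ∑ r ∈ Finset.range m,
      ‖(N : ℝ)⁻¹ • ∑ l ∈ Finset.range N, a (m * l + r)‖) atTop (𝓝 0) := by
    simpa using tendsto_finsetSum (Finset.range m) fun r _ => (h r).norm
  have h2 : Tendsto (fun n : ℕ => n / m) atTop atTop := Nat.tendsto_div_const_atTop hm.ne'
  have h3 : Tendsto (fun n : ℕ => (n : ℝ)⁻¹ * (m * M)) atTop (𝓝 0) := by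
    simpa using tendsto_inv_atTop_nhds_zero_nat.mul_const ((m : ℝ) * M)
  refine squeeze_zero_norm (fun n => ?_) (by simpa using (h1.comp h2).add h3)
  rcases Nat.eq_zero_or_pos n with rfl | hn
  · simp
  have hn' : (0 : ℝ) < n := by exact_mod_cast hn
  rw [norm_smul, norm_inv, Real.norm_natCast]
  have hsplit : ∑ i ∈ Finset.range n, a i
      = ∑ i ∈ Finset.range (m * (n / m)), a i
        + ∑ s ∈ Finset.range (n % m), a (m * (n / m) + s) := by
    rw [← Finset.sum_range_add, Nat.div_add_mod]
  have hrest : ‖∑ s ∈ Finset.range (n % m), a (m * (n / m) + s)‖ ≤ m * M := by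
    calc _ ≤ ∑ s ∈ Finset.range (n % m), M := norm_sum_le_of_le _ fun s _ => hM _
      _ = (n % m : ℕ) * M := by simp
      _ ≤ m * M := by gcongr; exact (Nat.mod_lt _ hm).le
  have hmain : (n : ℝ)⁻¹ * ‖∑ i ∈ Finset.range (m * (n / m)), a i‖
      ≤ ∑ r ∈ Finset.range m,
        ‖((n / m : ℕ) : ℝ)⁻¹ • ∑ l ∈ Finset.range (n / m), a (m * l + r)‖ := by
    rcases Nat.eq_zero_or_pos (n / m) with h0 | hp
    · simp [h0]
    have hp' : (0 : ℝ) < (n / m : ℕ) := by exact_mod_cast hp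
    rw [sum_range_mul_eq_sum_residues]
    calc _ ≤ ((n / m : ℕ) : ℝ)⁻¹ * ∑ r ∈ Finset.range m,
          ‖∑ l ∈ Finset.range (n / m), a (m * l + r)‖ := by
          gcongr
          · exact Nat.div_le_self n m
          · exact norm_sum_le _ _
      _ = _ := by simp [Finset.mul_sum, norm_smul]
  calc _ ≤ (n : ℝ)⁻¹ * (‖∑ i ∈ Finset.range (m * (n / m)), a i‖ + m * M) := by
        rw [hsplit]
        gcongr
        exact (norm_add_le _ _).trans (by gcongr)
    _ ≤ _ := by
        rw [mul_add]
        exact add_le_add_left hmain _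

theorem average_sub_const (a : ℕ → E) (x : E) {n : ℕ} (hn : 0 < n) :
    (n : ℝ)⁻¹ • ∑ i ∈ Finset.range n, (a i - x)
      = (n : ℝ)⁻¹ • ∑ i ∈ Finset.range n, a i - x := by
  have hn' : (n : ℝ) ≠ 0 := by exact_mod_cast hn.ne'
  rw [Finset.sum_sub_distrib, smul_sub, Finset.sum_const, Finset.card_range,
    ← Nat.cast_smul_eq_nsmul ℝ, smul_smul, inv_mul_cancel₀ hn', one_smul]

/-- The averages of a bounded sequence converge if they do so along each residue class. -/
theorem tendsto_average_of_residues {a : ℕ → E} {m : ℕ} (hm : 0 < m) {M : ℝ}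
    (hM : ∀ i, ‖a i‖ ≤ M) {x : E}
    (h : ∀ r, Tendsto (fun N : ℕ => (N : ℝ)⁻¹ • ∑ l ∈ Finset.range N, a (m * l + r))
      atTop (𝓝 x)) :
    Tendsto (fun n : ℕ => (n : ℝ)⁻¹ • ∑ i ∈ Finset.range n, a i) atTop (𝓝 x) := by
  have key : Tendsto (fun n : ℕ => (n : ℝ)⁻¹ • ∑ i ∈ Finset.range n, (a i - x)) atTop (𝓝 0) := by
    refine tendsto_average_zero_of_residues hm (M := M + ‖x‖)
      (fun i => (norm_sub_le _ _).trans (by gcongr; exact hM i)) fun r => ?_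
    rw [← sub_self x]
    refine ((h r).sub_const x).congr' ?_
    filter_upwards [eventually_gt_atTop 0] with N hN
    exact (average_sub_const (fun l => a (m * l + r)) x hN).symm
  have := key.add_const x
  rw [zero_add] at this
  refine this.congr' ?_
  filter_upwards [eventually_gt_atTop 0] with n hn
  rw [average_sub_const a x hn, sub_add_cancel]

omit [NormedSpace ℝ E] in
theorem tendsto_of_approx {a : ℕ → E} {x : E}
    (h : ∀ δ : ℝ, 0 < δ → ∃ (b : ℕ → E) (y : E), Tendsto b atTop (𝓝 y) ∧ ‖y - x‖ ≤ δ ∧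
      ∀ᶠ n in atTop, ‖a n - b n‖ ≤ δ) :
    Tendsto a atTop (𝓝 x) := by
  rw [Metric.tendsto_nhds]
  intro δ hδ
  obtain ⟨b, y, hb, hy, hab⟩ := h (δ / 3) (by positivity)
  filter_upwards [hab, Metric.tendsto_nhds.1 hb (δ / 3) (by positivity)] with n h1 h2
  rw [← dist_eq_norm] at h1 hy
  linarith [dist_triangle4 (a n) (b n) y x]

theorem norm_average_sub_le {a b : ℕ → E} {δ : ℝ} (h : ∀ i, ‖a i - b i‖ ≤ δ) (n : ℕ) :
    ‖(n : ℝ)⁻¹ • ∑ i ∈ Finset.range n, a i - (n : ℝ)⁻¹ • ∑ i ∈ Finset.range n, b i‖ ≤ δ := by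
  rcases Nat.eq_zero_or_pos n with rfl | hn
  · simpa using (norm_nonneg _).trans (h 0)
  have hn' : (0 : ℝ) < n := by exact_mod_cast hn
  rw [← smul_sub, ← Finset.sum_sub_distrib, norm_smul, norm_inv, Real.norm_natCast,
    inv_mul_le_iff₀ hn']
  exact (norm_sum_le_of_le _ fun i _ => h i).trans (by simp)

end Cesaro

/-! ### Tensors `x ⊗ y` as operators from the dual of `B` to `B`. -/

section Tensor

set_option maxSynthPendingDepth 3

variable (B : Type*) [NormedAddCommGroup B] [NormedSpace ℝ B]

/-- `(x, y) ↦ x ⊗ y`, as an operator from the dual of `B` to `B`. -/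
noncomputable def dualTensor : B →L[ℝ] B →L[ℝ] StrongDual ℝ B →L[ℝ] B :=
  (ContinuousLinearMap.smulRightL ℝ (StrongDual ℝ B) B).comp
    (NormedSpace.inclusionInDoubleDual ℝ B)

variable {B}

theorem dualTensor_apply (x y : B) (f : StrongDual ℝ B) : dualTensor B x y f = f x • y := rfl

theorem norm_dualTensor_le (x y : B) : ‖dualTensor B x y‖ ≤ ‖x‖ * ‖y‖ :=
  ContinuousLinearMap.opNorm_le_bound _ (by positivity) fun f => by
    rw [dualTensor_apply, norm_smul]
    have := f.le_opNorm x
    calc ‖f x‖ * ‖y‖ ≤ (‖f‖ * ‖x‖) * ‖y‖ := by gcongr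
      _ = _ := by ring

theorem continuous_dualTensor_self : Continuous fun x : B => dualTensor B x x :=
  (dualTensor B).continuous₂.comp (continuous_id.prodMk continuous_id)

theorem norm_dualTensor_self_sub_le (x y : B) :
    ‖dualTensor B x x - dualTensor B y y‖ ≤ ‖x - y‖ * (‖x‖ + ‖y‖) := by
  have h : dualTensor B x x - dualTensor B y y
      = dualTensor B (x - y) x + dualTensor B y (x - y) := by
    simp only [map_sub, sub_apply]
    abel
  rw [h]
  calc _ ≤ ‖dualTensor B (x - y) x‖ + ‖dualTensor B y (x - y)‖ := norm_add_le _ _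
    _ ≤ ‖x - y‖ * ‖x‖ + ‖y‖ * ‖x - y‖ :=
      add_le_add (norm_dualTensor_le _ _) (norm_dualTensor_le _ _)
    _ = _ := by ring

end Tensor

/-! ### The strong law for `X ⊗ X`. -/

namespace IsStandardARB1

set_option maxSynthPendingDepth 3

variable {B Ω : Type*} [NormedAddCommGroup B] [NormedSpace ℝ B]
  [TopologicalSpace.SeparableSpace B] [MeasurableSpace B] [BorelSpace B]
  [MeasurableSpace Ω] {μ : Measure Ω} {ρ : B →L[ℝ] B} {ε X : ℤ → Ω → B}

omit [TopologicalSpace.SeparableSpace B] [BorelSpace B] in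
theorem identDistrib_shift (hX : IsStandardARB1 μ ρ ε X) (h : ℤ) {γ : Type*}
    [MeasurableSpace γ] {g : (ℤ → B) → γ} (hg : Measurable g) :
    IdentDistrib (fun ω => g fun n => X (n + h) ω) (fun ω => g fun n => X n ω) μ μ := by
  have h0 : IdentDistrib (fun ω (n : ℤ) => X (n + h) ω) (fun ω (n : ℤ) => X n ω) μ μ :=
    ⟨(measurable_pi_lambda _ fun n => hX.measurable _).aemeasurable,
      (measurable_pi_lambda _ fun n => hX.measurable _).aemeasurable, hX.stationary h⟩
  exact h0.comp hg

omit [TopologicalSpace.SeparableSpace B] [BorelSpace B] in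
theorem ae_forall_of_ae (hX : IsStandardARB1 μ ρ ε X) {p : B → Prop}
    (hp : MeasurableSet {x | p x}) (h : ∀ᵐ ω ∂μ, p (X 0 ω)) : ∀ᵐ ω ∂μ, ∀ i, p (X i ω) := by
  rw [ae_all_iff]
  intro i
  have h1 := (hX.identDistrib_shift i (measurable_pi_apply (0 : ℤ))).symm
  simp only [zero_add] at h1
  exact h1.ae_snd hp h

omit [TopologicalSpace.SeparableSpace B] [BorelSpace B] in
/-- The part of the moving average expansion of `Xᵢ` made of the last `m` innovations. -/
theorem ae_eq_sum (hX : IsStandardARB1 μ ρ ε X) (m : ℕ) (i : ℤ) :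
    ∀ᵐ ω ∂μ, X i ω - (ρ ^ m) (X (i - m) ω)
      = ∑ j ∈ Finset.range m, (ρ ^ j) (ε (i - j) ω) := by
  induction m with
  | zero => simp
  | succ m ih =>
    filter_upwards [ih, hX.state (i - m)] with ω h1 h2
    rw [Finset.sum_range_succ, ← h1, h2, pow_succ]
    have : i - (m : ℤ) - 1 = i - ((m + 1 : ℕ) : ℤ) := by push_cast; ring
    rw [this]
    simp only [map_add, mul_apply_eq_comp]
    abel

/-- The two sums use innovations from the disjoint windows `(i - m, i]` and `(i' - m, i']`. -/
theorem indepFun_sum (hX : IsStandardARB1 μ ρ ε X) (m : ℕ) {i i' : ℤ} (hi : i + m ≤ i') :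
    IndepFun (fun ω => ∑ j ∈ Finset.range m, (ρ ^ j) (ε (i - j) ω))
      (fun ω => ∑ j ∈ Finset.range m, (ρ ^ j) (ε (i' - j) ω)) μ := by
  have : SecondCountableTopology B := UniformSpace.secondCountable_of_separable B
  let S : ℤ → Finset ℤ := fun i => Finset.Ioc (i - m) i
  -- The default `0` is never taken, since `i - j` lies in the window for every `j < m`.
  let g : (i : ℤ) → (S i → B) → B := fun i w =>
    ∑ j ∈ Finset.range m, (ρ ^ j) (if h : i - (j : ℤ) ∈ S i then w ⟨_, h⟩ else 0)
  have hg : ∀ i, Measurable (g i) := fun i => by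
    refine Finset.measurable_sum _ fun j _ => (ρ ^ j).continuous.measurable.comp ?_
    by_cases h : i - (j : ℤ) ∈ S i
    · simp only [h, dite_true]
      exact measurable_pi_apply _
    · simp only [h, dite_false]
      exact measurable_const
  have hgZ : ∀ i, (g i ∘ fun ω (a : S i) => ε a ω)
      = fun ω => ∑ j ∈ Finset.range m, (ρ ^ j) (ε (i - j) ω) := fun i => by
    funext ω
    refine Finset.sum_congr rfl fun j hj => ?_
    have : i - (j : ℤ) ∈ S i := by
      have := Finset.mem_range.1 hj
      simp only [S, Finset.mem_Ioc]
      omega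
    simp [this]
  have hdisj : Disjoint (S i) (S i') := by
    rw [Finset.disjoint_left]
    intro a
    simp only [S, Finset.mem_Ioc]
    omega
  have h := (hX.noise_indep.indepFun_finset _ _ hdisj hX.measurable_noise).comp (hg i) (hg i')
  rwa [hgZ, hgZ] at h

/-- The law of large numbers for the squares of the truncated moving averages. -/
theorem tendsto_average_truncation [CompleteSpace B] [IsProbabilityMeasure μ]
    (hX : IsStandardARB1 μ ρ ε X) {M : ℝ}
    (hM : ∀ᵐ ω ∂μ, ‖X 0 ω‖ ≤ M) {m : ℕ} (hm : 0 < m) {Y : ℤ → Ω → B}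
    (hY : Y = fun i ω => X i ω - (ρ ^ m) (X (i - m) ω)) :
    Integrable (fun ω => dualTensor B (Y 0 ω) (Y 0 ω)) μ ∧
    ∀ᵐ ω ∂μ, Tendsto (fun n : ℕ => (n : ℝ)⁻¹ •
      ∑ i ∈ Finset.range n, dualTensor B (Y i ω) (Y i ω)) atTop
        (𝓝 (∫ ω, dualTensor B (Y 0 ω) (Y 0 ω) ∂μ)) := by
  have : SecondCountableTopology B := UniformSpace.secondCountable_of_separable B
  let _ : MeasurableSpace (StrongDual ℝ B →L[ℝ] B) := borel _
  have : BorelSpace (StrongDual ℝ B →L[ℝ] B) := ⟨rfl⟩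
  have hall := hX.ae_forall_of_ae (p := fun x => ‖x‖ ≤ M)
    (isClosed_le continuous_norm continuous_const).measurableSet hM
  have hYm : ∀ i, Measurable (Y i) := fun i => by
    rw [hY]
    exact (hX.measurable _).sub ((ρ ^ m).continuous.measurable.comp (hX.measurable _))
  have hYb : ∀ᵐ ω ∂μ, ∀ i, ‖dualTensor B (Y i ω) (Y i ω)‖
      ≤ (M + ‖ρ ^ m‖ * M) * (M + ‖ρ ^ m‖ * M) := by
    filter_upwards [hall] with ω h i
    have hi : ‖Y i ω‖ ≤ M + ‖ρ ^ m‖ * M := by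
      rw [hY]
      exact (norm_sub_le _ _).trans
        (add_le_add (h i) (((ρ ^ m).le_opNorm _).trans (by gcongr; exact h _)))
    exact (norm_dualTensor_le _ _).trans
      (mul_le_mul hi hi (norm_nonneg _) ((norm_nonneg _).trans hi))
  have hTm := continuous_dualTensor_self (B := B)
  have hint : ∀ i, Integrable (fun ω => dualTensor B (Y i ω) (Y i ω)) μ := fun i =>
    Integrable.of_bound (hTm.comp_aestronglyMeasurable (hYm i).aestronglyMeasurable)
      ((M + ‖ρ ^ m‖ * M) * (M + ‖ρ ^ m‖ * M)) (hYb.mono fun ω h => h i)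
  have hident : ∀ i, IdentDistrib (fun ω => dualTensor B (Y i ω) (Y i ω))
      (fun ω => dualTensor B (Y 0 ω) (Y 0 ω)) μ μ := fun i => by
    have hg : Measurable fun x : ℤ → B => x 0 - (ρ ^ m) (x (0 - m)) :=
      (measurable_pi_apply _).sub ((ρ ^ m).continuous.measurable.comp (measurable_pi_apply _))
    have h := (hX.identDistrib_shift i hg).comp hTm.measurable
    have e : ∀ ω, X (0 + i) ω - (ρ ^ m) (X (0 - m + i) ω) = Y i ω := fun ω => by
      rw [hY, zero_add, zero_sub, neg_add_eq_sub]
    have e0 : ∀ ω, X 0 ω - (ρ ^ m) (X (0 - m) ω) = Y 0 ω := fun ω => by rw [hY]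
    simp only [Function.comp_def, e, e0] at h
    exact h
  have hindep : ∀ i i' : ℤ, i + m ≤ i' → IndepFun (fun ω => dualTensor B (Y i ω) (Y i ω))
      (fun ω => dualTensor B (Y i' ω) (Y i' ω)) μ := fun i i' hi => by
    -- The moving average identity is only almost sure, so independence is transferred along a.e.
    -- equality.
    have hz : ∀ i, (fun ω => ∑ j ∈ Finset.range m, (ρ ^ j) (ε (i - j) ω)) =ᵐ[μ] Y i := fun i => by
      filter_upwards [hX.ae_eq_sum m i] with ω h
      rw [hY, ← h]
    exact ((hX.indepFun_sum m hi).congr (hz i) (hz i')).comp hTm.measurable hTm.measurable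
  refine ⟨hint 0, ?_⟩
  have hres : ∀ᵐ ω ∂μ, ∀ r : ℕ, Tendsto (fun N : ℕ => (N : ℝ)⁻¹ •
      ∑ l ∈ Finset.range N,
        dualTensor B (Y ((m * l + r : ℕ) : ℤ) ω) (Y ((m * l + r : ℕ) : ℤ) ω)) atTop
        (𝓝 (∫ ω, dualTensor B (Y 0 ω) (Y 0 ω) ∂μ)) := by
    rw [ae_all_iff]
    intro r
    -- Distinct indices in one residue class are at least `m` apart, which gives the pairwise
    -- independence that the strong law needs.
    have h := strong_law_ae (μ := μ)
      (fun (l : ℕ) ω => dualTensor B (Y ((m * l + r : ℕ) : ℤ) ω) (Y ((m * l + r : ℕ) : ℤ) ω))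
      (hint _) (fun l l' hl => ?_) (fun l => (hident _).trans (hident _).symm)
    · rw [(hident ((m * 0 + r : ℕ) : ℤ)).integral_eq] at h
      exact h
    · have hstep : ∀ {l l' : ℕ}, l < l' →
          ((m * l + r : ℕ) : ℤ) + m ≤ ((m * l' + r : ℕ) : ℤ) := fun {l l'} h => by
        have := Nat.mul_le_mul_left m (Nat.succ_le_of_lt h)
        rw [Nat.mul_succ] at this
        omega
      rcases lt_or_gt_of_ne hl with h | h
      · exact hindep _ _ (hstep h)
      · exact (hindep _ _ (hstep h)).symm
  filter_upwards [hres, hYb] with ω h1 h2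
  exact tendsto_average_of_residues hm (fun i => h2 i) h1

omit [TopologicalSpace.SeparableSpace B] [BorelSpace B] in
theorem exists_norm_pow_lt (hX : IsStandardARB1 μ ρ ε X) {δ : ℝ} (hδ : 0 < δ) :
    ∃ m : ℕ, 0 < m ∧ ‖ρ ^ m‖ < δ := by
  obtain ⟨j, hj, h⟩ := hX.contraction
  obtain ⟨k, hk⟩ := exists_pow_lt_of_lt_one hδ h
  have h1 : ∀ n, ‖ρ ^ (j * (n + 1))‖ ≤ ‖ρ ^ j‖ ^ (n + 1) := fun n => by
    rw [pow_mul]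
    exact norm_pow_le' _ n.succ_pos
  -- `k + 1` keeps the exponent positive even if `k = 0`.
  refine ⟨j * (k + 1), by positivity, (h1 k).trans_lt (lt_of_le_of_lt ?_ hk)⟩
  exact pow_le_pow_of_le_one (norm_nonneg _) h.le (Nat.le_succ k)

/-- The law of large numbers for the empirical covariance of a bounded ARB(1) process, in the
norm of operators from the dual of `B` to `B`. -/
theorem tendsto_average_dualTensor [CompleteSpace B] [IsProbabilityMeasure μ]
    (hX : IsStandardARB1 μ ρ ε X) {M : ℝ} (hM : ∀ᵐ ω ∂μ, ‖X 0 ω‖ ≤ M) :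
    Integrable (fun ω => dualTensor B (X 0 ω) (X 0 ω)) μ ∧
    ∀ᵐ ω ∂μ, Tendsto (fun n : ℕ => (n : ℝ)⁻¹ •
      ∑ i ∈ Finset.range n, dualTensor B (X i ω) (X i ω)) atTop
        (𝓝 (∫ ω, dualTensor B (X 0 ω) (X 0 ω) ∂μ)) := by
  have : SecondCountableTopology B := UniformSpace.secondCountable_of_separable B
  have hM0 : 0 ≤ M := by
    obtain ⟨ω, hω⟩ := hM.exists
    exact (norm_nonneg _).trans hω
  have hall := hX.ae_forall_of_ae (p := fun x => ‖x‖ ≤ M)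
    (isClosed_le continuous_norm continuous_const).measurableSet hM
  have hintX : Integrable (fun ω => dualTensor B (X 0 ω) (X 0 ω)) μ := by
    refine Integrable.of_bound (continuous_dualTensor_self.comp_aestronglyMeasurable
      (hX.measurable 0).aestronglyMeasurable) (M * M) ?_
    filter_upwards [hM] with ω h
    exact (norm_dualTensor_le _ _).trans (by gcongr)
  refine ⟨hintX, ?_⟩
  have htr : ∀ᵐ ω ∂μ, ∀ m : ℕ, 0 < m → Tendsto (fun n : ℕ => (n : ℝ)⁻¹ •
      ∑ i ∈ Finset.range n, dualTensor B (X i ω - (ρ ^ m) (X (i - m) ω))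
        (X i ω - (ρ ^ m) (X (i - m) ω))) atTop
        (𝓝 (∫ ω, dualTensor B (X 0 ω - (ρ ^ m) (X (0 - m) ω))
          (X 0 ω - (ρ ^ m) (X (0 - m) ω)) ∂μ)) := by
    rw [ae_all_iff]
    intro m
    by_cases hm : 0 < m
    · filter_upwards [(hX.tendsto_average_truncation hM hm rfl).2] with ω h _
      exact h
    · exact .of_forall fun ω h => absurd h hm
  have hclose : ∀ m : ℕ, ‖ρ ^ m‖ ≤ 1 → ∀ᵐ ω ∂μ, ∀ i,
      ‖dualTensor B (X i ω) (X i ω) - dualTensor B (X i ω - (ρ ^ m) (X (i - m) ω))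
        (X i ω - (ρ ^ m) (X (i - m) ω))‖ ≤ ‖ρ ^ m‖ * (3 * M * M) := by
    intro m hm
    filter_upwards [hall] with ω h i
    have h1 : ‖(ρ ^ m) (X (i - m) ω)‖ ≤ ‖ρ ^ m‖ * M :=
      ((ρ ^ m).le_opNorm _).trans (by gcongr; exact h _)
    have h2 : ‖X i ω - (ρ ^ m) (X (i - m) ω)‖ ≤ 2 * M := by
      refine (norm_sub_le _ _).trans ?_
      nlinarith [h i]
    refine (norm_dualTensor_self_sub_le _ _).trans ?_
    rw [sub_sub_cancel]
    calc _ ≤ (‖ρ ^ m‖ * M) * (M + 2 * M) := by gcongr; exact h i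
      _ = _ := by ring
  have hcl : ∀ᵐ ω ∂μ, ∀ m : ℕ, ‖ρ ^ m‖ ≤ 1 → ∀ i,
      ‖dualTensor B (X i ω) (X i ω) - dualTensor B (X i ω - (ρ ^ m) (X (i - m) ω))
        (X i ω - (ρ ^ m) (X (i - m) ω))‖ ≤ ‖ρ ^ m‖ * (3 * M * M) := by
    rw [ae_all_iff]
    intro m
    by_cases hm : ‖ρ ^ m‖ ≤ 1
    · filter_upwards [hclose m hm] with ω h _
      exact h
    · exact .of_forall fun ω h => absurd h hm
  filter_upwards [htr, hcl] with ω h1 h2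
  refine tendsto_of_approx fun δ hδ => ?_
  -- Truncation costs at most `‖ρᵐ‖ · 3M²` per term once `‖ρᵐ‖ ≤ 1`; the `+ 1` avoids dividing by
  -- zero when `M = 0`.
  obtain ⟨m, hm, hρ⟩ := hX.exists_norm_pow_lt
    (δ := min 1 (δ / (3 * M * M + 1))) (by positivity)
  have hρ1 : ‖ρ ^ m‖ ≤ 1 := hρ.le.trans (min_le_left _ _)
  have hsmall : ‖ρ ^ m‖ * (3 * M * M) ≤ δ := by
    have hρ2 : ‖ρ ^ m‖ ≤ δ / (3 * M * M + 1) := hρ.le.trans (min_le_right _ _)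
    calc _ ≤ δ / (3 * M * M + 1) * (3 * M * M + 1) := by gcongr; linarith
      _ = δ := by field_simp
  refine ⟨_, _, h1 m hm, ?_, ?_⟩
  · rw [← integral_sub (hX.tendsto_average_truncation hM hm rfl).1 hintX]
    refine (norm_integral_le_of_norm_le_const (C := δ) ?_).trans (by simp)
    filter_upwards [hclose m hρ1] with ω h
    rw [norm_sub_rev]
    exact (h 0).trans hsmall
  · exact .of_forall fun n => norm_average_sub_le
      (fun i : ℕ => (h2 m hρ1 i).trans hsmall) n

end IsStandardARB1

/-! ### Covariance operators of the process, tested on the functionals. -/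

namespace KuelbsData

set_option maxSynthPendingDepth 3

variable {B Ω : Type*} [NormedAddCommGroup B] [NormedSpace ℝ B]
  [TopologicalSpace.SeparableSpace B] [MeasurableSpace B] [BorelSpace B]
  [MeasurableSpace Ω] {μ : Measure Ω} [IsProbabilityMeasure μ] (K : KuelbsData B)
  {ρ : B →L[ℝ] B} {ε X : ℤ → Ω → B} {lam : ℕ → ℝ} {φ : ℕ → K.Ht}

theorem integrable_rankOne_emb (hX : IsStandardARB1 μ ρ ε X) {M : ℝ}
    (hM : ∀ᵐ ω ∂μ, ‖X 0 ω‖ ≤ M) :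
    Integrable (fun ω => InnerProductSpace.rankOne ℝ (K.emb (X 0 ω)) (K.emb (X 0 ω))) μ := by
  have : SecondCountableTopology B := UniformSpace.secondCountable_of_separable B
  refine integrable_rankOne_of_bound (M := ‖K.emb‖ * M)
    (K.emb.continuous.comp_aestronglyMeasurable (hX.measurable 0).aestronglyMeasurable) ?_
  filter_upwards [hM] with ω h
  exact (K.emb.le_opNorm _).trans (by gcongr)

/-- Almost surely the process is orthogonal to the kernel of its covariance operator. -/
theorem ae_inner_emb_eq_zero (hX : IsStandardARB1 μ ρ ε X) {M : ℝ}
    (hM : ∀ᵐ ω ∂μ, ‖X 0 ω‖ ≤ M) {v : K.Ht}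
    (hv : covOp μ (fun ω => K.emb (X 0 ω)) v = 0) :
    ∀ᵐ ω ∂μ, ∀ i, ⟪K.emb (X i ω), v⟫_ℝ = 0 := by
  refine hX.ae_forall_of_ae (p := fun x => ⟪K.emb x, v⟫_ℝ = 0)
    (isClosed_eq (by fun_prop) continuous_const).measurableSet ?_
  have hI := K.integrable_rankOne_emb hX hM
  -- `E⟪X₀, v⟫² = ⟪C v, v⟫ = 0`, and a nonnegative function with zero integral vanishes a.e.
  have h0 := inner_covOp hI v v
  rw [hv, inner_zero_left] at h0
  have hnn : ∀ ω, 0 ≤ ⟪K.emb (X 0 ω), v⟫_ℝ * ⟪K.emb (X 0 ω), v⟫_ℝ := fun ω =>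
    mul_self_nonneg _
  filter_upwards [(integral_eq_zero_iff_of_nonneg hnn (integrable_inner_mul_inner hI v v)).1
    h0.symm] with ω h
  exact mul_self_eq_zero.1 h

/-- The difference of the kernels at `(F_p, F_q)` is that of the quadratic forms, and it only
depends on the components of the functionals along the eigenvectors of `C`. -/
theorem ae_enorm_inner_sub_le (hX : IsStandardARB1 μ ρ ε X) {M : ℝ}
    (hM : ∀ᵐ ω ∂μ, ‖X 0 ω‖ ≤ M)
    (hφ : IsSpectralSystem (covOp μ fun ω => K.emb (X 0 ω)) lam φ) :
    ∀ᵐ ω ∂μ, ∀ n p q,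
      ‖⟪(covOp μ (fun ω => K.emb (X 0 ω)) - empCovOp (fun i => K.emb (X i ω)) n) (K.riesz p),
        K.riesz q⟫_ℝ‖ₑ
        ≤ max (K.Nseq φ p) (K.Nseq φ q) *
          ‖covOp μ (fun ω => K.emb (X 0 ω)) - empCovOp (fun i => K.emb (X i ω)) n‖ₑ := by
  choose u hu hu2 using fun p => hφ.orthonormal.exists_projection (K.riesz p)
  -- The difference is orthogonal to every `φ j`, so all terms of the expansion of `C` vanish on it.
  have hC0 : ∀ p, covOp μ (fun ω => K.emb (X 0 ω)) (K.riesz p - u p) = 0 := fun p => by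
    have h := hφ.hasSum (K.riesz p - u p)
    simp only [inner_sub_left, hu, sub_self, mul_zero, zero_smul] at h
    exact h.unique hasSum_zero
  have hN : ∀ p, K.Nseq φ p = ‖u p‖ₑ ^ 2 := fun p => by
    rw [hu2, Nseq]
    simp only [real_inner_comm _ (K.riesz p), inner_riesz]
  filter_upwards [ae_all_iff.2 fun p => K.ae_inner_emb_eq_zero hX hM (hC0 p)] with ω hω n p q
  rw [hN, hN]
  have hD : ∀ p, (covOp μ (fun ω => K.emb (X 0 ω)) - empCovOp (fun i => K.emb (X i ω)) n)
      (K.riesz p) = (covOp μ (fun ω => K.emb (X 0 ω)) - empCovOp (fun i => K.emb (X i ω)) n)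
        (u p) := fun p => by
    rw [← sub_eq_zero, ← map_sub, sub_apply, hC0, empCovOp_eq_zero (hω p), sub_zero]
  refine enorm_inner_le_of_symmetric (fun x y => ?_) (hD p) (hD q)
  simp only [sub_apply, inner_sub_left, inner_sub_right]
  rw [real_inner_comm _ x, real_inner_comm _ x]
  simp only [inner_empCovOp, inner_covOp (K.integrable_rankOne_emb hX hM),
    mul_comm ⟪_, x⟫_ℝ]

/-- Bounded functionals commute with the Bochner integral; this moves the quadratic form from `H̃`
to the tensor on `B`. -/
theorem inner_covOp_riesz [CompleteSpace B] (hX : IsStandardARB1 μ ρ ε X) {M : ℝ}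
    (hM : ∀ᵐ ω ∂μ, ‖X 0 ω‖ ≤ M) (p q : ℕ) :
    ⟪covOp μ (fun ω => K.emb (X 0 ω)) (K.riesz p), K.riesz q⟫_ℝ
      = K.F q ((∫ ω, dualTensor B (X 0 ω) (X 0 ω) ∂μ) (K.F p)) := by
  have h := ((K.F q).comp (ContinuousLinearMap.apply ℝ B (K.F p))).integral_comp_comm
    (hX.tendsto_average_dualTensor hM).1
  simp only [ContinuousLinearMap.comp_apply, ContinuousLinearMap.apply_apply, dualTensor_apply,
    map_smul, smul_eq_mul] at h
  rw [inner_covOp (K.integrable_rankOne_emb hX hM), ← h]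
  simp only [inner_riesz, Fext_emb]

omit [TopologicalSpace.SeparableSpace B] [MeasurableSpace B] [BorelSpace B] in
theorem inner_empCovOp_riesz (x : ℤ → B) (n p q : ℕ) :
    ⟪empCovOp (fun i => K.emb (x i)) n (K.riesz p), K.riesz q⟫_ℝ
      = K.F q (((n : ℝ)⁻¹ • ∑ i ∈ Finset.range n, dualTensor B (x i) (x i)) (K.F p)) := by
  simp only [inner_empCovOp, inner_riesz, Fext_emb, smul_apply, sum_apply, dualTensor_apply,
    map_smul, map_sum, smul_eq_mul]

omit [TopologicalSpace.SeparableSpace B] [MeasurableSpace B] [BorelSpace B] in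
theorem enorm_apply_le (T : StrongDual ℝ B →L[ℝ] B) (p q : ℕ) :
    ‖K.F q (T (K.F p))‖ₑ ≤ ‖T‖ₑ := by
  have h : ‖K.F q (T (K.F p))‖ ≤ ‖T‖ := by
    refine ((K.F q).le_opNorm _).trans ?_
    rw [K.norm_F, one_mul]
    refine (T.le_opNorm _).trans ?_
    rw [K.norm_F, mul_one]
  rw [← ofReal_norm, ← ofReal_norm]
  exact ENNReal.ofReal_le_ofReal h

/-- The quadratic forms of the empirical covariance operators converge uniformly over the
pairs of functionals. -/
theorem ae_exists_enorm_inner_sub_le [CompleteSpace B] (hX : IsStandardARB1 μ ρ ε X) {M : ℝ}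
    (hM : ∀ᵐ ω ∂μ, ‖X 0 ω‖ ≤ M) :
    ∀ᵐ ω ∂μ, ∃ e : ℕ → ℝ≥0∞, Tendsto e atTop (𝓝 0) ∧ ∀ n p q,
      ‖⟪(covOp μ (fun ω => K.emb (X 0 ω)) - empCovOp (fun i => K.emb (X i ω)) n) (K.riesz p),
        K.riesz q⟫_ℝ‖ₑ ≤ e n := by
  filter_upwards [(hX.tendsto_average_dualTensor hM).2] with ω h
  -- The uniform error is the operator-norm distance from the empirical tensor to its mean.
  refine ⟨_, tendsto_iff_edist_tendsto_0.1 h, fun n p q => ?_⟩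
  rw [sub_apply, inner_sub_left, K.inner_covOp_riesz hX hM,
    K.inner_empCovOp_riesz (fun i => X i ω), ← map_sub, ← sub_apply, edist_comm,
    edist_eq_enorm_sub]
  exact K.enorm_apply_le _ p q

end KuelbsData

/-! ### The bounds and the convergence. -/

theorem lemma6 {B Ω : Type*} [NormedAddCommGroup B] [NormedSpace ℝ B] [CompleteSpace B]
    [TopologicalSpace.SeparableSpace B] [MeasurableSpace B] [BorelSpace B]
    [MeasurableSpace Ω] (μ : Measure Ω) [IsProbabilityMeasure μ]
    (K : KuelbsData B)
    (ρ : B →L[ℝ] B) (ε X : ℤ → Ω → B) (hX : IsStandardARB1 μ ρ ε X)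
    -- the autocovariance operators on `H̃`
    (C : K.Ht →L[ℝ] K.Ht) (hC : C = covOp μ (fun ω => K.emb (X 0 ω)))
    (Cn : ℕ → Ω → K.Ht →L[ℝ] K.Ht)
    (hCn : ∀ n ω, Cn n ω = empCovOp (fun i => K.emb (X i ω)) n)
    -- their eigenelements
    (lam : ℕ → ℝ) (φ : ℕ → K.Ht) (hφ : IsSpectralSystem C lam φ)
    (lamn : ℕ → Ω → ℕ → ℝ) (φn : ℕ → Ω → ℕ → K.Ht)
    (hφn : ∀ n, 2 ≤ n → ∀ᵐ ω ∂μ, IsEmpSpectralSystem n (Cn n ω) (lamn n ω) (φn n ω))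
    (k : ℕ → ℕ)
    (hA1 : AssumptionA1 μ X C lam)
    (hA2 : AssumptionA2 μ lamn k)
    (hA3 : K.AssumptionA3 ρ φ)
    (hA4 : K.AssumptionA4 lam φ)
    (hA5 : K.AssumptionA5 lam φ)
    (hk : (fun n : ℕ => Real.sqrt (k n) * gapSup lam (k n))
      =o[atTop] fun n : ℕ => Real.sqrt ((n : ℝ) / Real.log n)) :
    -- the bound for `‖c - cₙ‖`
    (∀ᵐ ω ∂μ, ∀ n, 2 ≤ n →
      kernelNorm (K.kernel lam φ - K.kernel (lamn n ω) (φn n ω)) ≤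
        svBound (K.Nsup φ)
          (⨆ l, ⨆ m, ‖K.Fext l (signAlign (φn n ω m) (φ m))‖ₑ)
          C (Cn n ω) φ (φn n ω) (k n) (gapSup lam (k n))) ∧
    -- its local form, at each pair of functionals
    (∀ᵐ ω ∂μ, ∀ n, 2 ≤ n → ∀ p q : ℕ,
      ‖K.kernel lam φ p q - K.kernel (lamn n ω) (φn n ω) p q‖ₑ ≤
        svBound (max (K.Nseq φ p) (K.Nseq φ q))
          (max (⨆ m, ‖K.Fext p (signAlign (φn n ω m) (φ m))‖ₑ)
            (⨆ m, ‖K.Fext q (signAlign (φn n ω m) (φ m))‖ₑ))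
          C (Cn n ω) φ (φn n ω) (k n) (gapSup lam (k n))) ∧
    -- almost sure convergence
    (∀ᵐ ω ∂μ, Tendsto
      (fun n => kernelNorm (K.kernel lam φ - K.kernel (lamn n ω) (φn n ω)))
      atTop (𝓝 0)) := by
  
  obtain ⟨⟨M, hM⟩, -⟩ := hA1
  obtain rfl : Cn = fun n ω => empCovOp (fun i => K.emb (X i ω)) n := by
    funext n ω
    exact hCn n ω
  subst hC
  have hker : ∀ᵐ ω ∂μ, ∀ n, 2 ≤ n → ∀ p q,
      K.kernel lam φ p q - K.kernel (lamn n ω) (φn n ω) p q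
        = ⟪(covOp μ (fun ω => K.emb (X 0 ω)) - empCovOp (fun i => K.emb (X i ω)) n)
            (K.riesz p), K.riesz q⟫_ℝ := by
    have h : ∀ᵐ ω ∂μ, ∀ n, 2 ≤ n → IsEmpSpectralSystem n
        (empCovOp (fun i => K.emb (X i ω)) n) (lamn n ω) (φn n ω) := by
      rw [ae_all_iff]
      intro n
      by_cases hn : 2 ≤ n
      · filter_upwards [hφn n hn] with ω h _
        exact h
      · exact .of_forall fun ω h => absurd h hn
    filter_upwards [h] with ω hω n hn p q
    have hsymm : ∀ x y, ⟪empCovOp (fun i => K.emb (X i ω)) n x, y⟫_ℝ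
        = ⟪x, empCovOp (fun i => K.emb (X i ω)) n y⟫_ℝ := fun x y => by
      rw [real_inner_comm _ x]
      simp only [inner_empCovOp, mul_comm ⟪_, x⟫_ℝ]
    rw [K.kernel_eq_inner (hφ.hasSum_inner _ _),
      K.kernel_eq_inner ((hω n hn).hasSum_inner hsymm _ _), sub_apply, inner_sub_left]
  have hbound := K.ae_enorm_inner_sub_le hX hM hφ
  refine ⟨?_, ?_, ?_⟩
  · filter_upwards [hker, hbound] with ω h1 h2 n hn
    refine (iSup₂_le fun p q => ?_).trans (le_svBound _ _ _ _ _ _ _ _)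
    rw [Pi.sub_apply, Pi.sub_apply, h1 n hn]
    exact (h2 n p q).trans (mul_le_mul_left (max_le (le_iSup _ p) (le_iSup _ q)) _)
  · filter_upwards [hker, hbound] with ω h1 h2 n hn p q
    rw [h1 n hn]
    exact (h2 n p q).trans (le_svBound _ _ _ _ _ _ _ _)
  · filter_upwards [hker, K.ae_exists_enorm_inner_sub_le hX hM] with ω h1 ⟨e, he, h2⟩
    refine tendsto_of_tendsto_of_tendsto_of_le_of_le' tendsto_const_nhds he
      (.of_forall fun n => zero_le) ?_
    -- The empirical eigenelements are specified only for `n ≥ 2`, so the comparison is an eventual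
    -- one.
    filter_upwards [eventually_ge_atTop 2] with n hn
    refine iSup₂_le fun p q => ?_
    rw [Pi.sub_apply, Pi.sub_apply, h1 n hn]
    exact h2 n p q
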